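/- \textbf{Setting.} Let $\mathcal S_0,\mathcal S_1,\mathcal S_2,\dots$ be measurable spaces, $\mathcal S_{1:0}=\{\varnothing\}$, $\mathcal S_{1:t}=\mathcal S_{1:t-1}\times\mathcal S_t$. Fix a prompt $s_0\in\mathcal S_0$ and a horizon $T\ge 2$. Let $\pi_{\rm ref}(\cdot\mid s_0,s_{1:t})$ be Markov kernels from $\mathcal S_{1:t}$ to $\mathcal S_{t+1}$ (the base model; for $t\ge T$ they play no role), and let $\hat V(s_0,\cdot):\mathcal S_{1:t}\to(0,\infty)$, $0\le t\le T$, be measurable (the reward model; write $\hat V(s_0)$ for its value at $\varnothing$). Write $Z_t(s_{1:t})=\mathbb E_{s_{t+1}\sim\pi_{\rm ref}(\cdot\mid s_0,s_{1:t})}[\hat V(s_0,s_{1:t+1})]$, and let $\tilde\pi_T(ds_{1:T})\propto\pi_{\rm ref}(ds_{1:T}\mid s_0)\,\hat V(s_0,s_{1:T})$ be the target distribution. Assume that for some $L>0$ and $\varepsilon\ge 0$: (A1) for all $1\le t\le T$ and all $s_{1:t}$, $\max\Big\{\frac{\hat V(s_0,s_{1:t-1})}{\hat V(s_0,s_{1:t})},\frac{\hat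 V(s_0,s_{1:t})}{\hat V(s_0,s_{1:t-1})}\Big\}\le L$; (A2) for all $1\le t\le T-1$ and all $s_{1:t}$, $\max\Big\{\frac{\hat V(s_0,s_{1:t})}{Z_t(s_{1:t})},\frac{Z_t(s_{1:t})}{\hat V(s_0,s_{1:t})}\Big\}\le 1+\varepsilon$. \textbf{SMC with the optimal proposal.} Let $\pi_{\rm p}(ds_{t+1}\mid s_0,s_{1:t})\propto\pi_{\rm ref}(ds_{t+1}\mid s_0,s_{1:t})\,\hat V(s_0,s_{1:t+1})$ and, for $1\le t\le T$, let $G_t(s_{1:t})=Z_{t-1}(s_{1:t-1})/\hat V(s_0,s_{1:t-1})$. Let $M_{t+1}$ be the kernel from $\mathcal S_{1:t}$ to $\mathcal S_{1:t+1}$ which keeps $s_{1:t}$ and appends $s_{t+1}\sim\pi_{\rm p}(\cdot\mid s_0,s_{1:t})$ for $t<T$, and let $M_{T+1}=\mathrm{Id}$ on $\mathcal S_{1:T}$. For a probability measure $\mu$ put $\Phi_{t+1}(\mu)(f)=\mu(G_t\,M_{t+1}f)/\mu(G_t)$. The Feynman--Kac flow is $\eta_1=\pi_{\rm p}(\cdot\mid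 s_0)$, $\eta_{t+1}=\Phi_{t+1}(\eta_t)$ for $1\le t\le T$. The particle system with $N\ge1$ particles starts from $X_1^1,\dots,X_1^N$ i.i.d. with law $\eta_1$; given the particles up to time $t$, with empirical measure $\eta_t^N=\frac1N\sum_i\delta_{X_t^i}$, the particles $X_{t+1}^1,\dots,X_{t+1}^N$ are i.i.d. with law $\Phi_{t+1}(\eta_t^N)$ (multinomial resampling with weights $G_t$, then propagation with $M_{t+1}$), for $1\le t\le T$. The output distribution is $\bar\eta_{T+1}^N=\mathbb E[\eta_{T+1}^N]$. Let $\|\mu-\nu\|_{\rm TV}=\sup_A|\mu(A)-\nu(A)|$. \textbf{Theorem.} Then $\eta_{T+1}=\tilde\pi_T$. For every $\delta_{\rm TV}\in(0,1)$ and every integer $N\ge1$ with $$N\ \ge\ \frac{\big((1+\varepsilon)^4-1\big)\,T^2\,(1+\varepsilon)^{6T}}{2\,\delta_{\rm TV}}$$ one has $\|\bar\eta_{T+1}^N-\eta_{T+1}\|_{\rm TV}\le\delta_{\rm TV}$. This sufficient number of particles does not depend on $L$. If $\varepsilon=0$, then $\bar\eta_{T+1}^N=\eta_{T+1}$ for every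 $N\ge1$; in particular a single particle samples exactly. -/

import Mathlib

open MeasureTheory ProbabilityTheory

open scoped ENNReal

namespace SMC

universe u

/-! ### Prefix spaces -/

/-- The space of prefixes `s_{1:t}`, with `S_{1:0} = {∅}` and `S_{1:t+1} = S_{1:t} × S_{t+1}`.
(`S 0` is the prompt space and does not enter.) -/
def Prefix (S : ℕ → Type u) : ℕ → Type u
  | 0 => PUnit
  | t + 1 => Prefix S t × S (t + 1)

instance Prefix.instMeasurableSpace (S : ℕ → Type u) [∀ t, MeasurableSpace (S t)] :
    ∀ t, MeasurableSpace (Prefix S t)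
  | 0 => inferInstanceAs (MeasurableSpace PUnit)
  | t + 1 =>
    letI := Prefix.instMeasurableSpace S t
    inferInstanceAs (MeasurableSpace (Prefix S t × S (t + 1)))

/-- The empty prefix. -/
def Prefix.nil (S : ℕ → Type u) : Prefix S 0 := PUnit.unit

/-- Appending one reasoning step to a prefix. -/
def Prefix.snoc {S : ℕ → Type u} {t : ℕ} (x : Prefix S t) (s : S (t + 1)) : Prefix S (t + 1) :=
  (x, s)

/-- The prefix with its last reasoning step removed. -/
def Prefix.init {S : ℕ → Type u} {t : ℕ} (x : Prefix S (t + 1)) : Prefix S t :=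
  Prod.fst x

noncomputable section

/-! ### Reweighting, Feynman-Kac steps and particles, on arbitrary spaces -/

section General

variable {E F : Type*} [MeasurableSpace E] [MeasurableSpace F]

/-- The normalized reweighting of `μ` by the weight `g`, i.e. `g μ / μ(g)`. -/
def reweight (μ : Measure E) (g : E → ℝ) : Measure E :=
  (∫⁻ x, ENNReal.ofReal (g x) ∂μ)⁻¹ • μ.withDensity (fun x => ENNReal.ofReal (g x))

/-- One step of the normalized Feynman-Kac flow, with potential `G` on `E` and Markov kernel `M`
from `E` to `F`: the measure `f ↦ μ(G · M f) / μ(G)`. -/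
def fkStep (G : E → ℝ) (M : Kernel E F) (μ : Measure E) : Measure F :=
  (reweight μ G).bind M

/-- The empirical measure of `N` particles. -/
def empirical {N : ℕ} (x : Fin N → E) : Measure E :=
  (N : ℝ≥0∞)⁻¹ • ∑ i, Measure.dirac (x i)

/-- One step of the particle system: conditionally on the current particles `x`, the new particles
are drawn independently from the Feynman-Kac update of the empirical measure of `x`. That update is
`∑ j, w̄ j • M (x j)` with `w̄ j = G (x j) / ∑ l, G (x l)`, so this is multinomial
resampling followed by independent propagation. -/
def particleStep {N : ℕ} (G : E → ℝ) (M : Kernel E F) (x : Fin N → E) : Measure (Fin N → F) :=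
  Measure.pi (fun _ => fkStep G M (empirical x))

/-- Total variation distance `sup_A |μ(A) - ν(A)|` (of probability measures). -/
def tvDist (μ ν : Measure E) : ℝ :=
  ⨆ A : {A : Set E // MeasurableSet A}, |μ.real A.1 - ν.real A.1|

end General

/-! ### The reasoning model, for a fixed prompt

`ref t` is the base model `π_ref(s_{t+1} | s_0, s_{1:t})` and `V t` is the reward model
`V̂(s_0, s_{1:t})`. -/

section Model

variable {S : ℕ → Type u} [∀ t, MeasurableSpace (S t)]
  (ref : ∀ t, Kernel (Prefix S t) (S (t + 1))) (V : ∀ t, Prefix S t → ℝ)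

/-- `E_{s_{t+1} ∼ π_ref(· | s_{1:t})} [V̂(s_{1:t+1})]`. -/
def expectedNext (t : ℕ) (x : Prefix S t) : ℝ :=
  ∫ s, V (t + 1) (x.snoc s) ∂(ref t x)

/-- Reward model ratio bound: consecutive rewards differ at most by the factor `L`. -/
def RewardRatioBound (T : ℕ) (L : ℝ) : Prop :=
  ∀ t < T, ∀ (x : Prefix S t) (s : S (t + 1)),
    V t x / V (t + 1) (x.snoc s) ≤ L ∧ V (t + 1) (x.snoc s) / V t x ≤ L

/-- Uniform bound on the one-step Bellman error, at the times `1 ≤ t < T` which have a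
next step and are not the bare prompt. -/
def BellmanErrorBound (T : ℕ) (ε : ℝ) : Prop :=
  ∀ t, 1 ≤ t → t < T → ∀ x : Prefix S t,
    V t x / expectedNext ref V t x ≤ 1 + ε ∧ expectedNext ref V t x / V t x ≤ 1 + ε

/-- The law of `s_{1:t}` under the base model. -/
def refLaw : ∀ t, Measure (Prefix S t)
  | 0 => Measure.dirac (Prefix.nil S)
  | t + 1 => Measure.compProd (refLaw t) (ref t)

/-- The reward-tilted distribution `π̃_t ∝ π_ref(s_{1:t}) V̂(s_{1:t})`. -/
def target (t : ℕ) : Measure (Prefix S t) :=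
  reweight (refLaw ref t) (V t)

variable [∀ t, IsMarkovKernel (ref t)]

/-- The optimal proposal `π_p(s_{t+1} | s_{1:t}) ∝ π_ref(s_{t+1} | s_{1:t}) V̂(s_{1:t+1})`. -/
def optimalProposal (t : ℕ) : Kernel (Prefix S t) (S (t + 1)) :=
  (ref t).withDensity
    (fun x s => ENNReal.ofReal (V (t + 1) (x.snoc s) / expectedNext ref V t x))

/-- The Markov propagation from `S_{1:t}` to `S_{1:t+1}`: keep the prefix and append a step drawn
from the optimal proposal. -/
def optimalKernel (t : ℕ) : Kernel (Prefix S t) (Prefix S (t + 1)) :=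
  show Kernel (Prefix S t) (Prefix S t × S (t + 1)) from
    Kernel.id ×ₖ optimalProposal ref V t

/-- The incremental weight of the optimal proposal,
`G_t(s_{1:t}) = E_{s_t ∼ π_ref(· | s_{1:t-1})} [V̂(s_{1:t})] / V̂(s_{1:t-1})` for `t ≥ 1`.
At `t = 0` all particles sit at the empty prefix and there is no reweighting. -/
def optimalPotential : ∀ t, Prefix S t → ℝ
  | 0, _ => 1
  | t + 1, x => expectedNext ref V t x.init / V t x.init

/-- The Feynman-Kac flow `η_t` of the optimal proposal. It starts from the empty prefix at time `0`,
so that `η_1` is the optimal proposal for the first step. -/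
def flow : ∀ t, Measure (Prefix S t)
  | 0 => Measure.dirac (Prefix.nil S)
  | t + 1 => fkStep (optimalPotential ref V t) (optimalKernel ref V t) (flow t)

/-- The terminal distribution `η_{T+1}`: one further step from `η_T`, with potential `G_T` and
the identity kernel. -/
def terminalFlow (T : ℕ) : Measure (Prefix S T) :=
  fkStep (optimalPotential ref V T) Kernel.id (flow ref V T)

/-- The joint law of the `N` particles at time `t`. At time `1` they are i.i.d. with law `η_1`. -/
def particleLaw (N : ℕ) : ∀ t, Measure (Fin N → Prefix S t)
  | 0 => Measure.dirac (fun _ => Prefix.nil S)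
  | t + 1 => (particleLaw N t).bind
      (particleStep (optimalPotential ref V t) (optimalKernel ref V t))

/-- The joint law of the `N` particles at time `T + 1`, after the terminal resampling step. -/
def terminalParticleLaw (N T : ℕ) : Measure (Fin N → Prefix S T) :=
  (particleLaw ref V N T).bind (particleStep (optimalPotential ref V T) Kernel.id)

/-- The output distribution `E[η^N_{T+1}]` of the sampler, i.e. the law of a uniformly chosen particle
at time `T + 1`. -/
def smcOutput (N T : ℕ) : Measure (Prefix S T) :=
  (terminalParticleLaw ref V N T).bind empirical

end Model

end

end SMC

namespace SMC

section General

variable {E F : Type*} [MeasurableSpace E] [MeasurableSpace F]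

/-! ### Integrals against binds, reweightings and empirical measures -/

/-! The flow is exact because `V̂_t · (V̂_{t+1}/Z_t) · (Z_t/V̂_t) = V̂_{t+1}`: proposal density and
next weight telescope (`withDensity_optimalPotential_bind`), so by induction the flow reweighted by
its potential is the tilted law.

For the bias, one tracks all ratios of empirical means `∑ a / ∑ b` with `0 ≤ a ≤ b` and `m ≤ b ≤ r
m`. This class is stable under a particle step: up to the bias of an i.i.d. sample, averaging such a
ratio over the new particles gives the same kind of ratio for `G · M a` and `G · M b` at the old
ones, and `r` grows by the oscillation `q` of `G`. The i.i.d. bias is at most `r (r - 1) / N` by a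
leave-one-out argument (`abs_integral_sum_div_sum_sub_le`). Hence the bias obeys `c_{t+1}(r) = r (r
- 1) / N + c_t(q r)` with `c_0 = 0` (`RatioBiasBound.fkStep`).

Total variation is the case of an indicator over `b = 1`, so `r = 1`. The Bellman error gives `q =
(1 + ε)²`, whereas `L` only secures positivity and finiteness; this is why the particle count is
free of `L`. For `ε = 0` one has `q = 1`, and every bias term vanishes. -/

theorem integrable_of_forall_mem_Icc {μ : Measure E} [IsFiniteMeasure μ] {f : E → ℝ}
    (hf : Measurable f) {m c : ℝ} (hb : ∀ x, f x ∈ Set.Icc m c) : Integrable f μ :=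
  Integrable.of_mem_Icc m c hf.aemeasurable (.of_forall hb)

theorem integral_bind_kernel {μ : Measure E} (κ : Kernel E F) {f : F → ℝ}
    (hf : Integrable f (μ.bind κ)) : ∫ y, f y ∂(μ.bind κ) = ∫ x, ∫ y, f y ∂(κ x) ∂μ := by
  have h : (κ ∘ₖ Kernel.const Unit μ) () = μ.bind κ := by
    rw [Kernel.comp_apply, Kernel.const_apply]
  rw [← h] at hf ⊢
  rw [Kernel.integral_comp hf, Kernel.const_apply]

theorem isProbabilityMeasure_bind {μ : Measure E} [IsProbabilityMeasure μ] {κ : E → Measure F}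
    (hκ : Measurable κ) (hprob : ∀ x, IsProbabilityMeasure (κ x)) :
    IsProbabilityMeasure (μ.bind κ) :=
  ⟨by simp [Measure.bind_apply .univ hκ.aemeasurable]⟩

theorem integral_bind {μ : Measure E} [IsProbabilityMeasure μ] {κ : E → Measure F}
    (hκ : Measurable κ) (hprob : ∀ x, IsProbabilityMeasure (κ x)) {f : F → ℝ} (hf : Measurable f)
    {m c : ℝ} (hb : ∀ y, f y ∈ Set.Icc m c) :
    ∫ y, f y ∂(μ.bind κ) = ∫ x, ∫ y, f y ∂(κ x) ∂μ := by
  have := isProbabilityMeasure_bind (μ := μ) hκ hprob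
  exact integral_bind_kernel ⟨κ, hκ⟩ (integrable_of_forall_mem_Icc hf hb)

theorem integral_mem_Icc {μ : Measure E} [IsProbabilityMeasure μ] {f : E → ℝ} (hf : Measurable f)
    {m c : ℝ} (hb : ∀ x, f x ∈ Set.Icc m c) : ∫ x, f x ∂μ ∈ Set.Icc m c := by
  have hi : Integrable f μ := integrable_of_forall_mem_Icc hf hb
  constructor
  · simpa using integral_mono (integrable_const m) hi fun x => (hb x).1
  · simpa using integral_mono hi (integrable_const c) fun x => (hb x).2

theorem integral_reweight (μ : Measure E) {g : E → ℝ} (hg : Measurable g) (hpos : ∀ x, 0 ≤ g x)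
    (f : E → ℝ) : ∫ x, f x ∂(reweight μ g) = (∫ x, g x * f x ∂μ) / ∫ x, g x ∂μ := by
  rw [reweight, integral_smul_measure, integral_withDensity_eq_integral_toReal_smul
    hg.ennreal_ofReal (.of_forall fun _ => ENNReal.ofReal_lt_top),
    integral_eq_lintegral_of_nonneg_ae (.of_forall hpos) hg.aestronglyMeasurable]
  simp only [ENNReal.toReal_ofReal (hpos _), smul_eq_mul, ENNReal.toReal_inv]
  ring

theorem isProbabilityMeasure_reweight {μ : Measure E} {g : E → ℝ}
    (h0 : ∫⁻ x, ENNReal.ofReal (g x) ∂μ ≠ 0) (hfin : ∫⁻ x, ENNReal.ofReal (g x) ∂μ ≠ ∞) :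
    IsProbabilityMeasure (reweight μ g) :=
  ⟨by simp [reweight, ENNReal.inv_mul_cancel h0 hfin]⟩

theorem lintegral_ofReal_ne_zero {μ : Measure E} [NeZero μ] {g : E → ℝ}
    (hg : Measurable g) (hpos : ∀ x, 0 < g x) : ∫⁻ x, ENNReal.ofReal (g x) ∂μ ≠ 0 := by
  rw [Ne, lintegral_eq_zero_iff hg.ennreal_ofReal]
  intro h
  have : ∀ᵐ _ ∂μ, False := h.mono fun x hx => (ENNReal.ofReal_pos.2 (hpos x)).ne' hx
  simp [NeZero.ne μ] at this

theorem lintegral_ofReal_ne_top {μ : Measure E} [IsFiniteMeasure μ] {g : E → ℝ} {c : ℝ}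
    (hc : ∀ x, g x ≤ c) : ∫⁻ x, ENNReal.ofReal (g x) ∂μ ≠ ∞ := by
  refine ne_top_of_le_ne_top (b := ENNReal.ofReal c * μ Set.univ) (by finiteness) ?_
  rw [← lintegral_const]
  exact lintegral_mono fun x => ENNReal.ofReal_le_ofReal (hc x)

/-- A reweighting depends only on the direction of the reweighted measure. -/
theorem reweight_eq_reweight {μ ν : Measure E} {g h : E → ℝ} {c : ℝ≥0∞} (hc0 : c ≠ 0)
    (hc : c ≠ ∞) (heq : μ.withDensity (fun x => ENNReal.ofReal (g x)) =
      c • ν.withDensity (fun x => ENNReal.ofReal (h x))) : reweight μ g = reweight ν h := by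
  have hmass := congrArg (fun ρ : Measure E => ρ Set.univ) heq
  simp only [withDensity_apply _ MeasurableSet.univ, Measure.restrict_univ, Measure.smul_apply,
    smul_eq_mul] at hmass
  rw [reweight, reweight, heq, hmass, smul_smul, ENNReal.mul_inv (.inl hc0) (.inl hc),
    mul_right_comm, ENNReal.inv_mul_cancel hc0 hc, one_mul]

/-! ### The particle step as a Markov kernel -/

theorem measurable_reweight {g : E → ℝ} (hg : Measurable g) :
    Measurable fun μ : Measure E => reweight μ g := by
  refine Measure.measurable_of_measurable_coe _ fun s hs => ?_
  simp only [reweight, Measure.smul_apply, smul_eq_mul, withDensity_apply _ hs]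
  simp only [← lintegral_indicator hs]
  exact (Measure.measurable_lintegral hg.ennreal_ofReal).inv.mul
    (Measure.measurable_lintegral (hg.ennreal_ofReal.indicator hs))

theorem measurable_empirical (N : ℕ) : Measurable (empirical : (Fin N → E) → Measure E) := by
  refine Measure.measurable_of_measurable_coe _ fun s hs => ?_
  simp only [empirical, Measure.smul_apply, Measure.finsetSum_apply, smul_eq_mul]
  refine Measurable.const_mul (Finset.measurable_sum _ fun i _ => ?_) _
  exact (Measure.measurable_coe hs).comp (Measure.measurable_dirac.comp (measurable_pi_apply i))

instance {N : ℕ} [NeZero N] (x : Fin N → E) : IsProbabilityMeasure (empirical x) :=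
  ⟨by simp [empirical, ENNReal.inv_mul_cancel, NeZero.ne N]⟩

theorem integral_empirical {N : ℕ} (x : Fin N → E) {f : E → ℝ} (hf : Measurable f) :
    ∫ y, f y ∂(empirical x) = (∑ i, f (x i)) / N := by
  rw [empirical, integral_smul_measure, integral_finsetSum_measure]
  · simp [integral_dirac' f _ hf.stronglyMeasurable, div_eq_inv_mul]
  · exact fun i _ => integrable_dirac' hf.stronglyMeasurable (by simp)

theorem isProbabilityMeasure_fkStep {G : E → ℝ} {M : Kernel E F} [IsMarkovKernel M]
    {μ : Measure E} [IsProbabilityMeasure μ] (hG : Measurable G) (hpos : ∀ x, 0 < G x) {c : ℝ}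
    (hc : ∀ x, G x ≤ c) : IsProbabilityMeasure (fkStep G M μ) :=
  have := isProbabilityMeasure_reweight (lintegral_ofReal_ne_zero (μ := μ) hG hpos)
    (lintegral_ofReal_ne_top hc)
  isProbabilityMeasure_bind M.measurable inferInstance

theorem integral_fkStep {G : E → ℝ} {M : Kernel E F} [IsMarkovKernel M]
    {μ : Measure E} [IsProbabilityMeasure μ] (hG : Measurable G) (hpos : ∀ x, 0 < G x) {c : ℝ}
    (hc : ∀ x, G x ≤ c) {f : F → ℝ} (hf : Measurable f) {m k : ℝ} (hb : ∀ y, f y ∈ Set.Icc m k) :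
    ∫ y, f y ∂(fkStep G M μ) = (∫ x, G x * ∫ y, f y ∂(M x) ∂μ) / ∫ x, G x ∂μ := by
  have := isProbabilityMeasure_reweight (lintegral_ofReal_ne_zero (μ := μ) hG hpos)
    (lintegral_ofReal_ne_top hc)
  rw [fkStep, integral_bind M.measurable inferInstance hf hb,
    integral_reweight μ hG fun x => (hpos x).le]

/-- Boxes form a generating π-system, and the mass of a box is a finite product of measurable
functions. -/
theorem measurable_measure_pi {ι : Type*} [Fintype ι] {κ : E → Measure F} (hκ : Measurable κ)
    (hprob : ∀ x, IsProbabilityMeasure (κ x)) :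
    Measurable fun x => Measure.pi fun _ : ι => κ x := by
  refine Measurable.measure_of_isPiSystem_of_isProbabilityMeasure generateFrom_pi.symm
    isPiSystem_pi ?_
  rintro _ ⟨s, hs, rfl⟩
  simp only [Measure.pi_pi]
  exact Finset.measurable_prod _ fun i _ => (Measure.measurable_coe (hs i trivial)).comp hκ

theorem measurable_particleStep {N : ℕ} [NeZero N] {G : E → ℝ} {M : Kernel E F} [IsMarkovKernel M]
    (hG : Measurable G) (hpos : ∀ x, 0 < G x) {c : ℝ} (hc : ∀ x, G x ≤ c) :
    Measurable (particleStep (N := N) G M) :=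
  measurable_measure_pi ((Measure.measurable_bind' M.measurable).comp
      ((measurable_reweight hG).comp (measurable_empirical N)))
    fun _ => isProbabilityMeasure_fkStep hG hpos hc

theorem isProbabilityMeasure_particleStep {N : ℕ} [NeZero N] {G : E → ℝ} {M : Kernel E F}
    [IsMarkovKernel M] (hG : Measurable G) (hpos : ∀ x, 0 < G x) {c : ℝ} (hc : ∀ x, G x ≤ c)
    (x : Fin N → E) : IsProbabilityMeasure (particleStep G M x) :=
  have := isProbabilityMeasure_fkStep (μ := empirical x) (M := M) hG hpos hc
  inferInstanceAs (IsProbabilityMeasure (Measure.pi fun _ => fkStep G M (empirical x)))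

/-! ### Bias of the ratio of empirical means -/

/-- Coordinate `i` is independent of the others, so the integral factors through the mean of `d`. -/
theorem integral_mul_comp_sum_erase_eq_zero {ι : Type*} [Fintype ι] [DecidableEq ι]
    (μ : Measure E) [IsProbabilityMeasure μ] {b d : E → ℝ} (hb : Measurable b) (hd : Measurable d)
    (hd0 : ∫ x, d x ∂μ = 0) (i : ι) {φ : ℝ → ℝ} (hφ : Measurable φ) :
    ∫ x : ι → E, d (x i) * φ (∑ j ∈ Finset.univ.erase i, b (x j)) ∂(Measure.pi fun _ => μ) = 0 := by
  have hind : iIndepFun (fun i (x : ι → E) => x i) (Measure.pi fun _ => μ) :=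
    iIndepFun_pi (X := fun _ => id) fun _ => aemeasurable_id
  have h := hind.indepFun_finset {i} (Finset.univ.erase i) (by simp) fun i => measurable_pi_apply i
  have h2 : IndepFun (fun x : ι → E => d (x i))
      (fun x : ι → E => φ (∑ j ∈ Finset.univ.erase i, b (x j))) (Measure.pi fun _ => μ) := by
    have h3 := h.comp
      (φ := fun y : ↥({i} : Finset ι) → E => d (y ⟨i, Finset.mem_singleton_self i⟩))
      (ψ := fun y : ↥(Finset.univ.erase i) → E => φ (∑ j, b (y j)))
      (by fun_prop) (by fun_prop)
    have hsum : ∀ x : ι → E,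
        ∑ j ∈ Finset.univ.erase i, b (x j) = ∑ j : ↥(Finset.univ.erase i), b (x j) :=
      fun x => (Finset.sum_coe_sort _ fun j => b (x j)).symm
    simp only [hsum]
    exact h3
  rw [h2.integral_fun_mul_eq_mul_integral
    (Measurable.aestronglyMeasurable (by fun_prop)) (Measurable.aestronglyMeasurable (by fun_prop)),
    integral_comp_eval (μ := fun _ : ι => μ) (f := d) hd.aestronglyMeasurable, hd0, zero_mul]

theorem sum_div_sum_mem_Icc {ι : Type*} {s : Finset ι} {a b : ι → ℝ} (ha : ∀ i, 0 ≤ a i)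
    (hab : ∀ i, a i ≤ b i) : (∑ i ∈ s, a i) / ∑ i ∈ s, b i ∈ Set.Icc (0 : ℝ) 1 :=
  ⟨div_nonneg (Finset.sum_nonneg fun i _ => ha i)
      (Finset.sum_nonneg fun i _ => (ha i).trans (hab i)),
    div_le_one_of_le₀ (Finset.sum_le_sum fun i _ => hab i)
      (Finset.sum_nonneg fun i _ => (ha i).trans (hab i))⟩

/-- The error of the ratio is `∑ d(x_i) / B` with `d = a - θ b` centred and `B = ∑ b(x_j)`.
Replacing `b(x_i)` by its mean in the `i`-th denominator makes that term integrate to zero. What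
remains is of second order, giving a bias of order `1/N` rather than `1/√N`. -/
theorem abs_integral_sum_div_sum_sub_le {N : ℕ} [NeZero N] (μ : Measure E) [IsProbabilityMeasure μ]
    {a b : E → ℝ} (ha : Measurable a) (hb : Measurable b) {m r : ℝ} (hm : 0 < m)
    (ha0 : ∀ x, 0 ≤ a x) (hab : ∀ x, a x ≤ b x) (hmb : ∀ x, b x ∈ Set.Icc m (r * m)) :
    |∫ x : Fin N → E, (∑ i, a (x i)) / (∑ i, b (x i)) ∂(Measure.pi fun _ => μ)
      - (∫ x, a x ∂μ) / ∫ x, b x ∂μ| ≤ r * (r - 1) / N := by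
  have hN : (0 : ℝ) < N := by exact_mod_cast NeZero.pos N
  set β := ∫ x, b x ∂μ with hβ
  have hβm : β ∈ Set.Icc m (r * m) := integral_mem_Icc hb hmb
  have hβ0 : 0 < β := hm.trans_le hβm.1
  have hr : 1 ≤ r := by nlinarith [hβm.1, hβm.2]
  have hac : ∀ x, a x ∈ Set.Icc 0 (r * m) := fun x => ⟨ha0 x, (hab x).trans (hmb x).2⟩
  have hai : Integrable a μ := integrable_of_forall_mem_Icc ha hac
  have hbi : Integrable b μ := integrable_of_forall_mem_Icc hb hmb
  set θ := (∫ x, a x ∂μ) / β with hθ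
  have hθ0 : 0 ≤ θ := div_nonneg (integral_nonneg ha0) hβ0.le
  have hθ1 : θ ≤ 1 := div_le_one_of_le₀ (integral_mono hai hbi hab) hβ0.le
  set d : E → ℝ := fun x => a x - θ * b x with hd
  have hdm : Measurable d := by fun_prop
  have hd0 : ∫ x, d x ∂μ = 0 := by
    rw [hd, integral_sub hai (hbi.const_mul θ), integral_const_mul, ← hβ, hθ,
      div_mul_cancel₀ _ hβ0.ne', sub_self]
  have hdb : ∀ x, |d x| ≤ r * m := fun x => by
    have h1 := ha0 x
    have h2 := hab x
    have h3 := (hmb x).1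
    have h4 := (hmb x).2
    rw [abs_le]
    constructor <;> simp only [hd] <;> nlinarith
  have hBlow : ∀ (x : Fin N → E), N * m ≤ ∑ i, b (x i) := fun x => by
    simpa using Finset.card_nsmul_le_sum Finset.univ (fun i => b (x i)) m fun i _ => (hmb _).1
  set B' : Fin N → (Fin N → E) → ℝ := fun i x => ∑ j ∈ Finset.univ.erase i, b (x j) + β with hB'
  have hB'eq : ∀ i x, B' i x = ∑ j, b (x j) - b (x i) + β := fun i x => by
    simp only [hB', ← Finset.add_sum_erase _ (fun j => b (x j)) (Finset.mem_univ i)]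
    ring
  -- The `N - 1` remaining terms and `β` are each at least `m`.
  have hB'low : ∀ i x, N * m ≤ B' i x := fun i x => by
    have h := Finset.card_nsmul_le_sum (Finset.univ.erase i) (fun i => b (x i)) m
      fun i _ => (hmb _).1
    have hN1 : 1 ≤ N := NeZero.pos N
    rw [Finset.card_erase_of_mem (Finset.mem_univ i), Finset.card_fin, nsmul_eq_mul,
      Nat.cast_sub hN1, Nat.cast_one] at h
    simp only [hB']
    linarith [hβm.1]
  have hNm : 0 < N * m := by positivity
  set P : Measure (Fin N → E) := Measure.pi fun _ => μ with hP
  have hterm : ∀ i (x : Fin N → E), |d (x i) * (1 / ∑ j, b (x j) - 1 / B' i x)| ≤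
      r * (r - 1) / N ^ 2 := fun i x => by
    have h1 := hBlow x
    have h2 := hB'low i x
    have hB0 : 0 < ∑ j, b (x j) := hNm.trans_le h1
    have hB'0 : 0 < B' i x := hNm.trans_le h2
    have h3 : |β - b (x i)| ≤ (r - 1) * m := by
      have h4 := hmb (x i)
      rw [abs_le]
      constructor <;> linarith [h4.1, h4.2, hβm.1, hβm.2]
    have h5 : 1 / ∑ j, b (x j) - 1 / B' i x = (β - b (x i)) / ((∑ j, b (x j)) * B' i x) := by
      rw [div_sub_div _ _ hB0.ne' hB'0.ne', hB'eq]
      ring_nf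
    rw [h5, abs_mul, abs_div, abs_of_pos (mul_pos hB0 hB'0)]
    calc |d (x i)| * (|β - b (x i)| / ((∑ j, b (x j)) * B' i x))
        ≤ (r * m) * ((r - 1) * m / ((N * m) * (N * m))) := by
          gcongr
          exact hdb _
      _ = r * (r - 1) / N ^ 2 := by field_simp
  have hbsum : Measurable fun x : Fin N → E => ∑ j, b (x j) := by fun_prop
  have hB'm : ∀ i, Measurable (B' i) := fun i => by fun_prop
  have hint1 : ∀ i, Integrable
      (fun x : Fin N → E => d (x i) * (1 / ∑ j, b (x j) - 1 / B' i x)) P := fun i =>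
    Integrable.of_bound (Measurable.aestronglyMeasurable (by have := hB'm i; fun_prop)) _
      (.of_forall fun x => (Real.norm_eq_abs _).trans_le (hterm i x))
  have hint2 : ∀ i, Integrable (fun x : Fin N → E => d (x i) * (1 / B' i x)) P := fun i =>
    Integrable.of_bound (C := r * m * (1 / (N * m)))
      (Measurable.aestronglyMeasurable (by have := hB'm i; fun_prop)) (.of_forall fun x => by
        have h2 := hB'low i x
        rw [Real.norm_eq_abs, abs_mul, abs_of_pos (one_div_pos.2 (hNm.trans_le h2))]
        exact mul_le_mul (hdb _) (one_div_le_one_div_of_le hNm h2)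
          (one_div_pos.2 (hNm.trans_le h2)).le (by positivity))
  have hzero : ∀ i, ∫ x : Fin N → E, d (x i) * (1 / B' i x) ∂P = 0 := fun i =>
    integral_mul_comp_sum_erase_eq_zero μ hb hdm hd0 i (φ := fun y => 1 / (y + β)) (by fun_prop)
  have hratio : Integrable (fun x : Fin N → E => (∑ i, a (x i)) / (∑ i, b (x i))) P :=
    integrable_of_forall_mem_Icc (by fun_prop)
      fun x => sum_div_sum_mem_Icc (fun i => ha0 (x i)) fun i => hab (x i)
  have hkey : ∫ x : Fin N → E, (∑ i, a (x i)) / (∑ i, b (x i)) ∂P - θ =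
      ∑ i, ∫ x : Fin N → E, d (x i) * (1 / ∑ j, b (x j) - 1 / B' i x) ∂P := by
    calc ∫ x : Fin N → E, (∑ i, a (x i)) / (∑ i, b (x i)) ∂P - θ
        = ∫ x : Fin N → E, ((∑ i, a (x i)) / (∑ i, b (x i)) - θ) ∂P := by
          rw [integral_sub hratio (integrable_const _)]
          simp
      _ = ∫ x : Fin N → E, ∑ i, (d (x i) * (1 / ∑ j, b (x j) - 1 / B' i x)
            + d (x i) * (1 / B' i x)) ∂P := by
          refine integral_congr_ae (.of_forall fun x => ?_)
          have hB0 : 0 < ∑ j, b (x j) := hNm.trans_le (hBlow x)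
          simp only [← mul_add, sub_add_cancel, ← Finset.sum_mul, hd, Finset.sum_sub_distrib,
            ← Finset.mul_sum]
          field_simp
      _ = _ := by
          rw [integral_finsetSum _ fun i _ => by exact (hint1 i).add (hint2 i)]
          refine Finset.sum_congr rfl fun i _ => ?_
          rw [integral_add (hint1 i) (hint2 i), hzero, add_zero]
  rw [hkey]
  calc |∑ i, ∫ x : Fin N → E, d (x i) * (1 / ∑ j, b (x j) - 1 / B' i x) ∂P|
      ≤ ∑ i : Fin N, r * (r - 1) / N ^ 2 := by
        refine (Finset.abs_sum_le_sum_abs _ _).trans (Finset.sum_le_sum fun i _ => ?_)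
        simpa using norm_integral_le_of_norm_le_const (μ := P)
          (.of_forall fun x => (Real.norm_eq_abs _).trans_le (hterm i x))
    _ = r * (r - 1) / N := by
        rw [Finset.sum_const, Finset.card_fin, nsmul_eq_mul]
        field_simp

/-! ### Propagation of the ratio bias and passage to total variation -/

/-- The law of `N` particles approximates `η` in the sense that ratios of empirical means have
bias at most `c r`, where `r` bounds the oscillation of the denominator. -/
def RatioBiasBound {N : ℕ} (law : Measure (Fin N → E)) (η : Measure E) (c : ℝ → ℝ) : Prop :=
  ∀ (a b : E → ℝ) (m r : ℝ), Measurable a → Measurable b → 0 < m → (∀ x, 0 ≤ a x) →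
    (∀ x, a x ≤ b x) → (∀ x, b x ∈ Set.Icc m (r * m)) →
    |∫ x, (∑ i, a (x i)) / (∑ i, b (x i)) ∂law - (∫ x, a x ∂η) / ∫ x, b x ∂η| ≤ c r

/-- Only `r ≥ 1` matters, since `m ≤ ∫ b ≤ r m` with `m > 0`. -/
theorem RatioBiasBound.mono {N : ℕ} {law : Measure (Fin N → E)} {η : Measure E}
    [IsProbabilityMeasure η] {c c' : ℝ → ℝ} (h : RatioBiasBound law η c)
    (hc : ∀ r, 1 ≤ r → c r ≤ c' r) : RatioBiasBound law η c' := by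
  intro a b m r ha hb hm ha0 hab hmb
  have := integral_mem_Icc (μ := η) hb hmb
  exact (h a b m r ha hb hm ha0 hab hmb).trans (hc r (by nlinarith [this.1, this.2]))

theorem ratioBiasBound_dirac {N : ℕ} [NeZero N] (y : E) :
    RatioBiasBound (Measure.dirac fun _ : Fin N => y) (Measure.dirac y) 0 := by
  intro a b m r ha hb hm ha0 hab hmb
  rw [integral_dirac' _ _ ha.stronglyMeasurable, integral_dirac' _ _ hb.stronglyMeasurable,
    integral_dirac' _ _ (Measurable.stronglyMeasurable (by fun_prop))]
  have hN : (N : ℝ) ≠ 0 := by exact_mod_cast NeZero.ne N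
  simp [mul_div_mul_left _ _ hN]

/-- Given the old particles, the new ones are i.i.d., which costs `r (r - 1) / N`. The conditional
limit is a ratio in the old particles with denominator `G · M b`, to which the hypothesis applies at
`q r`. -/
theorem RatioBiasBound.fkStep {N : ℕ} [NeZero N] {law : Measure (Fin N → E)}
    [IsProbabilityMeasure law] {η : Measure E} [IsProbabilityMeasure η] {c : ℝ → ℝ}
    (h : RatioBiasBound law η c) {G : E → ℝ} {M : Kernel E F} [IsMarkovKernel M]
    (hG : Measurable G) {g q : ℝ} (hg : 0 < g) (hGb : ∀ x, G x ∈ Set.Icc g (q * g)) :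
    RatioBiasBound (law.bind (particleStep G M)) (fkStep G M η)
      (fun r => r * (r - 1) / N + c (q * r)) := by
  intro a b m r ha hb hm ha0 hab hmb
  have hGpos : ∀ x, 0 < G x := fun x => hg.trans_le (hGb x).1
  have hGle : ∀ x, G x ≤ q * g := fun x => (hGb x).2
  have hac : ∀ x, a x ∈ Set.Icc 0 (r * m) := fun x => ⟨ha0 x, (hab x).trans (hmb x).2⟩
  have hMa : Measurable fun x => ∫ y, a y ∂(M x) := ha.stronglyMeasurable.integral_kernel.measurable
  have hMb : Measurable fun x => ∫ y, b y ∂(M x) := hb.stronglyMeasurable.integral_kernel.measurable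
  set a' : E → ℝ := fun x => G x * ∫ y, a y ∂(M x) with ha'
  set b' : E → ℝ := fun x => G x * ∫ y, b y ∂(M x) with hb'
  have ha'm : Measurable a' := hG.mul hMa
  have hb'm : Measurable b' := hG.mul hMb
  have ha'0 : ∀ x, 0 ≤ a' x := fun x => mul_nonneg (hGpos x).le (integral_nonneg ha0)
  have hab' : ∀ x, a' x ≤ b' x := fun x => by
    refine mul_le_mul_of_nonneg_left (integral_mono ?_ ?_ hab) (hGpos x).le
    · exact integrable_of_forall_mem_Icc ha hac
    · exact integrable_of_forall_mem_Icc hb hmb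
  have hmb' : ∀ x, b' x ∈ Set.Icc (g * m) (q * r * (g * m)) := fun x => by
    have h1 := integral_mem_Icc (μ := M x) hb hmb
    have h2 := hGb x
    refine ⟨mul_le_mul h2.1 h1.1 hm.le (hGpos x).le, ?_⟩
    calc b' x ≤ (q * g) * (r * m) :=
          mul_le_mul h2.2 h1.2 (hm.le.trans h1.1) (hg.le.trans (h2.1.trans h2.2))
      _ = _ := by ring
  -- The normalizer `ν(G)` cancels, so the ratio class absorbs the nonlinearity of the step.
  have hratio : ∀ (ν : Measure E) [IsProbabilityMeasure ν],
      (∫ x, a x ∂(SMC.fkStep G M ν)) / ∫ x, b x ∂(SMC.fkStep G M ν) =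
        (∫ x, a' x ∂ν) / ∫ x, b' x ∂ν := fun ν _ => by
    rw [integral_fkStep hG hGpos hGle ha hac, integral_fkStep hG hGpos hGle hb hmb]
    have h1 := integral_mem_Icc (μ := ν) hG hGb
    exact div_div_div_cancel_right₀ (hg.trans_le h1.1).ne' _ _
  have hN : (0 : ℝ) < N := by exact_mod_cast NeZero.pos N
  have hmr : ∀ x : Fin N → F, (∑ i, a (x i)) / (∑ i, b (x i)) ∈ Set.Icc (0 : ℝ) 1 :=
    fun x => sum_div_sum_mem_Icc (fun i => ha0 (x i)) fun i => hab (x i)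
  have hKm := measurable_particleStep (N := N) (M := M) hG hGpos hGle
  have hKp := isProbabilityMeasure_particleStep (N := N) (M := M) hG hGpos hGle
  have hqm : Measurable fun x : Fin N → F => (∑ i, a (x i)) / (∑ i, b (x i)) := by fun_prop
  have hstep : ∀ x : Fin N → E,
      |∫ y, (∑ i, a (y i)) / (∑ i, b (y i)) ∂(particleStep G M x)
        - (∑ i, a' (x i)) / (∑ i, b' (x i))| ≤ r * (r - 1) / N := fun x => by
    have hp := isProbabilityMeasure_fkStep (μ := empirical x) (M := M) hG hGpos hGle
    have h1 := abs_integral_sum_div_sum_sub_le (N := N) (SMC.fkStep G M (empirical x)) ha hb hm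
      ha0 hab hmb
    rw [hratio, integral_empirical x ha'm, integral_empirical x hb'm,
      div_div_div_cancel_right₀ hN.ne'] at h1
    exact h1
  have hI1 : Integrable (fun x : Fin N → E =>
      ∫ y, (∑ i, a (y i)) / (∑ i, b (y i)) ∂(particleStep G M x)) law := by
    refine integrable_of_forall_mem_Icc (m := 0) (c := 1) ?_ fun x =>
      integral_mem_Icc hqm hmr
    exact (hqm.stronglyMeasurable.integral_kernel
      (κ := (⟨particleStep G M, hKm⟩ : Kernel _ _))).measurable
  have hI2 : Integrable (fun x : Fin N → E => (∑ i, a' (x i)) / (∑ i, b' (x i))) law :=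
    integrable_of_forall_mem_Icc (by fun_prop)
      fun x => sum_div_sum_mem_Icc (fun i => ha'0 (x i)) fun i => hab' (x i)
  have hrec := h a' b' (g * m) (q * r) ha'm hb'm (mul_pos hg hm) ha'0 hab' hmb'
  rw [integral_bind hKm hKp hqm hmr, hratio]
  refine (abs_sub_le _ (∫ x, (∑ i, a' (x i)) / (∑ i, b' (x i)) ∂law) _).trans
    (add_le_add ?_ hrec)
  rw [← integral_sub hI1 hI2]
  simpa using norm_integral_le_of_norm_le_const (μ := law)
    (.of_forall fun x => (Real.norm_eq_abs _).trans_le (hstep x))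

/-- The count `N` is written as a sum of ones to exhibit a ratio of the controlled class. -/
theorem measureReal_bind_empirical {N : ℕ} [NeZero N] (law : Measure (Fin N → E))
    [IsProbabilityMeasure law] {A : Set E} (hA : MeasurableSet A) :
    (law.bind empirical).real A =
      ∫ x, (∑ i, A.indicator (1 : E → ℝ) (x i)) / (∑ _i : Fin N, 1) ∂law := by
  have hm : Measurable (A.indicator (1 : E → ℝ)) := measurable_one.indicator hA
  rw [← integral_indicator_one hA, integral_bind (measurable_empirical N) inferInstance hm
    (m := 0) (c := 1)]
  · simp [integral_empirical _ hm]
  · intro y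
    by_cases hy : y ∈ A <;> simp [hy]

theorem RatioBiasBound.tvDist_le {N : ℕ} [NeZero N] {law : Measure (Fin N → E)}
    [IsProbabilityMeasure law] {η : Measure E} [IsProbabilityMeasure η] {c : ℝ → ℝ}
    (h : RatioBiasBound law η c) : tvDist (law.bind empirical) η ≤ c 1 := by
  have : Nonempty {A : Set E // MeasurableSet A} := ⟨⟨∅, .empty⟩⟩
  refine ciSup_le fun ⟨A, hA⟩ => ?_
  have hm : Measurable (A.indicator (1 : E → ℝ)) := measurable_one.indicator hA
  have h1 := h (A.indicator 1) 1 1 1 hm measurable_one one_pos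
    (fun x => Set.indicator_nonneg (by simp) x) (fun x => Set.indicator_le_self' (by simp) x)
    (by simp)
  rw [measureReal_bind_empirical law hA, ← integral_indicator_one (μ := η) hA]
  simpa using h1

theorem abs_sub_le_tvDist {μ ν : Measure E} [IsProbabilityMeasure μ] [IsProbabilityMeasure ν]
    {A : Set E} (hA : MeasurableSet A) : |μ.real A - ν.real A| ≤ tvDist μ ν := by
  refine le_ciSup (f := fun A : {A : Set E // MeasurableSet A} => |μ.real A.1 - ν.real A.1|)
    ⟨1, ?_⟩ ⟨A, hA⟩
  rintro _ ⟨B, rfl⟩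
  have h1 : μ.real B.1 ∈ Set.Icc 0 1 := ⟨measureReal_nonneg, measureReal_le_one⟩
  have h2 : ν.real B.1 ∈ Set.Icc 0 1 := ⟨measureReal_nonneg, measureReal_le_one⟩
  exact abs_sub_le_iff.2 ⟨by linarith [h1.2, h2.1], by linarith [h1.1, h2.2]⟩

theorem eq_of_tvDist_le_zero {μ ν : Measure E} [IsProbabilityMeasure μ] [IsProbabilityMeasure ν]
    (h : tvDist μ ν ≤ 0) : μ = ν := by
  ext A hA
  have h1 := abs_nonpos_iff.1 ((abs_sub_le_tvDist (μ := μ) (ν := ν) hA).trans h)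
  exact (measureReal_eq_measureReal_iff).1 (sub_eq_zero.1 h1)

end General

/-! ### The optimal proposal and its one-step identities -/

section Model

variable {S : ℕ → Type*} {V : ∀ t, Prefix S t → ℝ}

theorem RewardRatioBound.snoc_mem_Icc {T : ℕ} {L : ℝ} (h : RewardRatioBound V T L) (hL : 0 < L)
    (hpos : ∀ t ≤ T, ∀ x, 0 < V t x) {t : ℕ} (ht : t < T) (x : Prefix S t) (s : S (t + 1)) :
    V (t + 1) (x.snoc s) ∈ Set.Icc (V t x / L) (L * V t x) := by
  obtain ⟨h1, h2⟩ := h t ht x s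
  rw [div_le_iff₀ (hpos (t + 1) ht _)] at h1
  rw [div_le_iff₀ (hpos t ht.le _)] at h2
  exact ⟨(div_le_iff₀' hL).2 h1, h2⟩

/-- Iterating the ratio bound from the single empty prefix; used to make normalizers finite. -/
theorem RewardRatioBound.exists_le {T : ℕ} {L : ℝ} (h : RewardRatioBound V T L) (hL : 0 < L)
    (hpos : ∀ t ≤ T, ∀ x, 0 < V t x) : ∀ t ≤ T, ∃ c, ∀ x, V t x ≤ c
  | 0, _ => ⟨V 0 (Prefix.nil S), fun _ => le_rfl⟩
  | t + 1, ht => by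
    obtain ⟨c, hc⟩ := h.exists_le hL hpos t (Nat.le_of_succ_le ht)
    refine ⟨L * c, fun x => ?_⟩
    exact (h.snoc_mem_Icc hL hpos ht x.init x.2).2.trans (mul_le_mul_of_nonneg_left (hc _) hL.le)

variable [∀ t, MeasurableSpace (S t)]

theorem Prefix.measurable_snoc (t : ℕ) :
    Measurable fun p : Prefix S t × S (t + 1) => Prefix.snoc p.1 p.2 :=
  measurable_id

theorem Prefix.measurable_init (t : ℕ) :
    Measurable (Prefix.init : Prefix S (t + 1) → Prefix S t) :=
  measurable_fst

variable {ref : ∀ t, Kernel (Prefix S t) (S (t + 1))} [∀ t, IsMarkovKernel (ref t)]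

instance refLaw.instIsProbabilityMeasure : ∀ t, IsProbabilityMeasure (refLaw ref t)
  | 0 => inferInstanceAs (IsProbabilityMeasure (Measure.dirac (Prefix.nil S)))
  | t + 1 =>
    have := refLaw.instIsProbabilityMeasure t
    inferInstanceAs (IsProbabilityMeasure (Measure.compProd (refLaw ref t) (ref t)))

section Step

variable {t : ℕ}

theorem measurable_uncurry_snoc (hV : Measurable (V (t + 1))) :
    Measurable (Function.uncurry fun (x : Prefix S t) (s : S (t + 1)) => V (t + 1) (x.snoc s)) :=
  hV.comp (Prefix.measurable_snoc t)

theorem measurable_apply_snoc (hV : Measurable (V (t + 1))) (x : Prefix S t) :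
    Measurable fun s : S (t + 1) => V (t + 1) (x.snoc s) :=
  (measurable_uncurry_snoc hV).of_uncurry_left

theorem measurable_expectedNext (hV : Measurable (V (t + 1))) : Measurable (expectedNext ref V t) :=
  (measurable_uncurry_snoc hV).stronglyMeasurable.integral_kernel_prod_right.measurable

theorem expectedNext_pos (hV : Measurable (V (t + 1)))
    {l u : Prefix S t → ℝ} (hl : ∀ x, 0 < l x)
    (hlu : ∀ x s, V (t + 1) (Prefix.snoc x s) ∈ Set.Icc (l x) (u x)) (x : Prefix S t) :
    0 < expectedNext ref V t x :=
  (hl x).trans_le (integral_mem_Icc (measurable_apply_snoc hV x) (hlu x)).1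

theorem lintegral_optimalProposal (hV : Measurable (V (t + 1))) (x : Prefix S t)
    {f : S (t + 1) → ℝ≥0∞} (hf : Measurable f) :
    ∫⁻ s, f s ∂(optimalProposal ref V t x) = ∫⁻ s,
      ENNReal.ofReal (V (t + 1) (x.snoc s) / expectedNext ref V t x) * f s ∂(ref t x) := by
  refine Kernel.lintegral_withDensity _ ?_ x hf
  exact ((measurable_uncurry_snoc hV).div
    ((measurable_expectedNext hV).comp measurable_fst)).ennreal_ofReal

theorem isMarkovKernel_optimalProposal (hV : Measurable (V (t + 1)))
    {l u : Prefix S t → ℝ} (hl : ∀ x, 0 < l x)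
    (hlu : ∀ x s, V (t + 1) (Prefix.snoc x s) ∈ Set.Icc (l x) (u x)) :
    IsMarkovKernel (optimalProposal ref V t) := by
  refine ⟨fun x => ⟨?_⟩⟩
  have hZ : 0 < expectedNext ref V t x := expectedNext_pos hV hl hlu x
  have hm := measurable_apply_snoc hV x
  rw [← lintegral_one, lintegral_optimalProposal hV x measurable_const]
  simp only [mul_one]
  rw [← ofReal_integral_eq_lintegral_ofReal, integral_div]
  · rw [← expectedNext, div_self hZ.ne', ENNReal.ofReal_one]
  · exact (integrable_of_forall_mem_Icc hm (hlu x)).div_const _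
  · exact .of_forall fun s => div_nonneg ((hl x).le.trans (hlu x s).1) hZ.le

theorem isMarkovKernel_optimalKernel (hV : Measurable (V (t + 1)))
    {l u : Prefix S t → ℝ} (hl : ∀ x, 0 < l x)
    (hlu : ∀ x s, V (t + 1) (Prefix.snoc x s) ∈ Set.Icc (l x) (u x)) :
    IsMarkovKernel (optimalKernel ref V t) :=
  have := isMarkovKernel_optimalProposal (ref := ref) hV hl hlu
  inferInstanceAs (IsMarkovKernel (Kernel.id ×ₖ optimalProposal ref V t))

theorem lintegral_optimalKernel (hV : Measurable (V (t + 1)))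
    {l u : Prefix S t → ℝ} (hl : ∀ x, 0 < l x)
    (hlu : ∀ x s, V (t + 1) (Prefix.snoc x s) ∈ Set.Icc (l x) (u x)) (x : Prefix S t)
    {f : Prefix S (t + 1) → ℝ≥0∞} (hf : Measurable f) : ∫⁻ y, f y ∂(optimalKernel ref V t x) = ∫⁻ s,
      ENNReal.ofReal (V (t + 1) (x.snoc s) / expectedNext ref V t x) * f (x.snoc s) ∂(ref t x) := by
  have := isMarkovKernel_optimalProposal (ref := ref) hV hl hlu
  have h1 : ∫⁻ y, f y ∂(optimalKernel ref V t x) =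
      ∫⁻ s, f (x.snoc s) ∂(optimalProposal ref V t x) :=
    Kernel.lintegral_id_prod (κ := optimalProposal ref V t) (f := f) (a := x) hf
  rw [h1, lintegral_optimalProposal hV]
  exact (hf.comp (Prefix.measurable_snoc t)).comp measurable_prodMk_left

/-- Reweighting the optimal propagation of `V̂ π_ref` by the next potential gives back
`V̂ π_ref` at the next time. -/
theorem withDensity_optimalPotential_bind (hV : Measurable (V (t + 1)))
    {l u : Prefix S t → ℝ} (hl : ∀ x, 0 < l x)
    (hlu : ∀ x s, V (t + 1) (Prefix.snoc x s) ∈ Set.Icc (l x) (u x))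
    (hVt : Measurable (V t)) (hpos : ∀ x, 0 < V t x) :
    (((refLaw ref t).withDensity fun x => ENNReal.ofReal (V t x)).bind
        (optimalKernel ref V t)).withDensity
      (fun y => ENNReal.ofReal (optimalPotential ref V (t + 1) y)) =
    (refLaw ref (t + 1)).withDensity fun y => ENNReal.ofReal (V (t + 1) y) := by
  have hZm := measurable_expectedNext (ref := ref) hV
  have hG : Measurable (optimalPotential ref V (t + 1)) :=
    (hZm.div hVt).comp (Prefix.measurable_init t)
  have := isMarkovKernel_optimalKernel (ref := ref) hV hl hlu
  ext A hA
  have hGA := hG.ennreal_ofReal.indicator hA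
  have hVA := hV.ennreal_ofReal.indicator hA
  rw [withDensity_apply _ hA, withDensity_apply _ hA, ← lintegral_indicator hA,
    ← lintegral_indicator hA, Measure.lintegral_bind (Kernel.aemeasurable _) hGA.aemeasurable,
    lintegral_withDensity_eq_lintegral_mul _ hVt.ennreal_ofReal
      (hGA.lintegral_kernel (κ := optimalKernel ref V t))]
  refine Eq.trans ?_ (Measure.lintegral_compProd (μ := refLaw ref t) (κ := ref t) hVA).symm
  refine lintegral_congr fun x => ?_
  have hZ : 0 < expectedNext ref V t x := expectedNext_pos hV hl hlu x
  have hVx := hpos x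
  rw [Pi.mul_apply, lintegral_optimalKernel hV hl hlu x hGA, ← lintegral_const_mul']
  swap
  · exact ENNReal.ofReal_ne_top
  refine lintegral_congr fun s => ?_
  by_cases hs : x.snoc s ∈ A
  · have h1 : optimalPotential ref V (t + 1) (x.snoc s) = expectedNext ref V t x / V t x := rfl
    have hVs : 0 ≤ V (t + 1) (x.snoc s) := (hl x).le.trans (hlu x s).1
    change _ = A.indicator _ (x.snoc s)
    rw [Set.indicator_of_mem hs, Set.indicator_of_mem hs, h1,
      ← ENNReal.ofReal_mul (by positivity), ← ENNReal.ofReal_mul hVx.le]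
    congr 1
    -- The telescoping cancellation of `Z_t` and `V̂_t`.
    field_simp
  · change _ = A.indicator _ (x.snoc s)
    rw [Set.indicator_of_notMem hs, Set.indicator_of_notMem hs, mul_zero, mul_zero]

end Step

/-! ### Exactness of the flow and bias over the whole horizon -/

section Horizon

variable {T : ℕ} {L ε : ℝ}

theorem isMarkovKernel_optimalKernel_of_lt (hmeas : ∀ t ≤ T, Measurable (V t))
    (hpos : ∀ t ≤ T, ∀ x, 0 < V t x) (hL : 0 < L) (hratio : RewardRatioBound V T L)
    {t : ℕ} (ht : t < T) :
    IsMarkovKernel (optimalKernel ref V t) :=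
  isMarkovKernel_optimalKernel (hmeas (t + 1) ht) (fun x => div_pos (hpos t ht.le x) hL)
    (hratio.snoc_mem_Icc hL hpos ht)

theorem measurable_optimalPotential (hmeas : ∀ t ≤ T, Measurable (V t)) {t : ℕ} (ht : t ≤ T) :
    Measurable (optimalPotential ref V t) := by
  cases t with
  | zero => exact measurable_const
  | succ t => exact ((measurable_expectedNext (hmeas (t + 1) ht)).div
      (hmeas t (Nat.le_of_succ_le ht))).comp (Prefix.measurable_init t)

/-- The incremental weights oscillate at most by the factor `(1 + ε)²`: the first two are constant,
and the later ones are controlled by the Bellman error. -/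
theorem exists_optimalPotential_mem_Icc (hmeas : ∀ t ≤ T, Measurable (V t))
    (hpos : ∀ t ≤ T, ∀ x, 0 < V t x) (hL : 0 < L) (hratio : RewardRatioBound V T L)
    (hε : 0 ≤ ε) (hbellman : BellmanErrorBound ref V T ε)
    {t : ℕ} (ht : t ≤ T) :
    ∃ g, 0 < g ∧ ∀ x, optimalPotential ref V t x ∈ Set.Icc g ((1 + ε) ^ 2 * g) := by
  have hq : 1 ≤ (1 + ε) ^ 2 := one_le_pow₀ (by linarith)
  match t, ht with
  | 0, _ => exact ⟨1, one_pos, fun x => ⟨le_rfl, by simpa [optimalPotential] using hq⟩⟩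
  | 1, h1 =>
    have hc : 0 < expectedNext ref V 0 (Prefix.nil S) / V 0 (Prefix.nil S) :=
      div_pos (expectedNext_pos (hmeas 1 h1) (fun x => div_pos (hpos 0 (Nat.zero_le _) x) hL)
        (hratio.snoc_mem_Icc hL hpos h1) _) (hpos 0 (Nat.zero_le _) _)
    -- `x.init` is the empty prefix definitionally, so the potential is this constant.
    exact ⟨_, hc, fun x => ⟨le_rfl, le_mul_of_one_le_left hc.le hq⟩⟩
  | t + 2, h2 =>
    refine ⟨(1 + ε)⁻¹, by positivity, fun x => ?_⟩
    obtain ⟨h3, h4⟩ := hbellman (t + 1) (Nat.le_add_left _ _) h2 x.init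
    have hZ : 0 < expectedNext ref V (t + 1) x.init :=
      expectedNext_pos (hmeas (t + 2) h2)
        (fun x => div_pos (hpos (t + 1) (Nat.le_of_succ_le h2) x) hL)
        (hratio.snoc_mem_Icc hL hpos h2) _
    have hVx := hpos (t + 1) (Nat.le_of_succ_le h2) x.init
    constructor
    · change _ ≤ expectedNext ref V (t + 1) x.init / V (t + 1) x.init
      rw [← inv_div]
      exact inv_anti₀ (div_pos hVx hZ) h3
    · change expectedNext ref V (t + 1) x.init / V (t + 1) x.init ≤ _
      rwa [pow_two, mul_assoc, mul_inv_cancel₀ (by positivity), mul_one]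

theorem reweight_flow_eq_target (hmeas : ∀ t ≤ T, Measurable (V t))
    (hpos : ∀ t ≤ T, ∀ x, 0 < V t x) (hL : 0 < L) (hratio : RewardRatioBound V T L) :
    ∀ t ≤ T, reweight (flow ref V t) (optimalPotential ref V t) = target ref V t
  | 0, _ => by
    have hm := (hmeas 0 (Nat.zero_le _)).ennreal_ofReal
    have hm' := (measurable_optimalPotential (ref := ref) hmeas (Nat.zero_le T)).ennreal_ofReal
    have hp := hpos 0 (Nat.zero_le _) (Prefix.nil S)
    refine reweight_eq_reweight (c := (ENNReal.ofReal (V 0 (Prefix.nil S)))⁻¹) (by simp)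
      (by simpa using hp) ?_
    change (Measure.dirac _).withDensity _ = _ • (Measure.dirac _).withDensity _
    rw [dirac_withDensity' hm, dirac_withDensity' hm', smul_smul,
      ENNReal.inv_mul_cancel (by simpa using hp) ENNReal.ofReal_ne_top]
    simp [optimalPotential]
  | t + 1, ht => by
    obtain ⟨c, hc⟩ := hratio.exists_le hL hpos t (Nat.le_of_succ_le ht)
    have hmt := hmeas t (Nat.le_of_succ_le ht)
    have hpt := hpos t (Nat.le_of_succ_le ht)
    -- By induction the flow at `t + 1` propagates the normalized target at `t`; its normalizer is
    -- the only discrepancy.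
    refine reweight_eq_reweight (c := (∫⁻ x, ENNReal.ofReal (V t x) ∂(refLaw ref t))⁻¹)
      (ENNReal.inv_ne_zero.2 (lintegral_ofReal_ne_top hc))
      (ENNReal.inv_ne_top.2 (lintegral_ofReal_ne_zero hmt hpt)) ?_
    have hflow : flow ref V (t + 1) = (target ref V t).bind (optimalKernel ref V t) := by
      rw [← reweight_flow_eq_target hmeas hpos hL hratio t (Nat.le_of_succ_le ht)]
      rfl
    rw [hflow, target, reweight, Measure.bind_smul, withDensity_smul_measure,
      withDensity_optimalPotential_bind (hmeas (t + 1) ht) (fun x => div_pos (hpt x) hL)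
        (hratio.snoc_mem_Icc hL hpos ht) hmt hpt]

theorem terminalFlow_eq_target (hmeas : ∀ t ≤ T, Measurable (V t))
    (hpos : ∀ t ≤ T, ∀ x, 0 < V t x) (hL : 0 < L) (hratio : RewardRatioBound V T L) :
    terminalFlow ref V T = target ref V T := by
  rw [terminalFlow, fkStep, reweight_flow_eq_target hmeas hpos hL hratio T le_rfl]
  exact Measure.bind_dirac

/-- With `q = (1 + ε)²`, unrolling the recursion gives a sum of `q^k r (q^k r - 1) / N` over `k <
t`, bounded by `t` times its last term. The exponent `t - 1` is written as a division by `q`, which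
is harmless at `t = 0`. -/
theorem ratioBiasBound_particleLaw (hmeas : ∀ t ≤ T, Measurable (V t))
    (hpos : ∀ t ≤ T, ∀ x, 0 < V t x) (hL : 0 < L) (hratio : RewardRatioBound V T L)
    (hε : 0 ≤ ε) (hbellman : BellmanErrorBound ref V T ε)
    (N : ℕ) [NeZero N] : ∀ t ≤ T, IsProbabilityMeasure (flow ref V t) ∧
      IsProbabilityMeasure (particleLaw ref V N t) ∧
      RatioBiasBound (particleLaw ref V N t) (flow ref V t)
        (fun r => t * (((1 + ε) ^ 2) ^ t * r / (1 + ε) ^ 2 *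
          (((1 + ε) ^ 2) ^ t * r / (1 + ε) ^ 2 - 1) / N))
  | 0, _ => by
    refine ⟨Measure.dirac.isProbabilityMeasure, Measure.dirac.isProbabilityMeasure, ?_⟩
    have h := ratioBiasBound_dirac (N := N) (Prefix.nil S)
    simp only [Nat.cast_zero, zero_mul]
    exact h
  | t + 1, ht => by
    obtain ⟨h1, h2, h3⟩ := ratioBiasBound_particleLaw hmeas hpos hL hratio hε hbellman N t
      (Nat.le_of_succ_le ht)
    obtain ⟨g, hg, hGb⟩ := exists_optimalPotential_mem_Icc hmeas hpos hL hratio hε hbellman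
      (Nat.le_of_succ_le ht)
    have hG : Measurable (optimalPotential ref V t) :=
      measurable_optimalPotential hmeas (Nat.le_of_succ_le ht)
    have hGpos : ∀ x, 0 < optimalPotential ref V t x := fun x => hg.trans_le (hGb x).1
    have := isMarkovKernel_optimalKernel_of_lt (ref := ref) hmeas hpos hL hratio ht
    have hflow : IsProbabilityMeasure (flow ref V (t + 1)) :=
      isProbabilityMeasure_fkStep hG hGpos fun x => (hGb x).2
    refine ⟨hflow, isProbabilityMeasure_bind
      (measurable_particleStep hG hGpos fun x => (hGb x).2)
      (isProbabilityMeasure_particleStep hG hGpos fun x => (hGb x).2), ?_⟩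
    have hstep : RatioBiasBound (particleLaw ref V N (t + 1)) (flow ref V (t + 1)) _ :=
      h3.fkStep (M := optimalKernel ref V t) hG hg hGb
    refine hstep.mono fun r hr => ?_
    have hq : 1 ≤ (1 + ε) ^ 2 := one_le_pow₀ (by linarith)
    set q := (1 + ε) ^ 2
    have hN : (0 : ℝ) < N := by exact_mod_cast NeZero.pos N
    have h4 : q ^ t * (q * r) / q = q ^ (t + 1) * r / q := by ring
    have h5 : r ≤ q ^ (t + 1) * r / q := by
      rw [pow_succ, mul_right_comm, mul_div_cancel_right₀ _ (by positivity)]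
      exact le_mul_of_one_le_left (by linarith) (one_le_pow₀ hq)
    have h6 : r * (r - 1) / N ≤
        q ^ (t + 1) * r / q * (q ^ (t + 1) * r / q - 1) / N := by
      gcongr
    simp only [h4]
    push_cast
    linarith

theorem tvDist_smcOutput_le (hmeas : ∀ t ≤ T, Measurable (V t))
    (hpos : ∀ t ≤ T, ∀ x, 0 < V t x) (hL : 0 < L) (hratio : RewardRatioBound V T L)
    (hε : 0 ≤ ε) (hbellman : BellmanErrorBound ref V T ε)
    (N : ℕ) [NeZero N] : IsProbabilityMeasure (smcOutput ref V N T) ∧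
      IsProbabilityMeasure (terminalFlow ref V T) ∧
      tvDist (smcOutput ref V N T) (terminalFlow ref V T) ≤
        T * (((1 + ε) ^ 2) ^ T * (((1 + ε) ^ 2) ^ T - 1) / N) := by
  obtain ⟨h1, h2, h3⟩ := ratioBiasBound_particleLaw hmeas hpos hL hratio hε hbellman N T le_rfl
  obtain ⟨g, hg, hGb⟩ := exists_optimalPotential_mem_Icc hmeas hpos hL hratio hε hbellman le_rfl
  have hG : Measurable (optimalPotential ref V T) :=
    measurable_optimalPotential hmeas le_rfl
  have hGpos : ∀ x, 0 < optimalPotential ref V T x := fun x => hg.trans_le (hGb x).1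
  have hη : IsProbabilityMeasure (terminalFlow ref V T) :=
    isProbabilityMeasure_fkStep hG hGpos fun x => (hGb x).2
  have hlaw : IsProbabilityMeasure (terminalParticleLaw ref V N T) := isProbabilityMeasure_bind
    (measurable_particleStep hG hGpos fun x => (hGb x).2)
    (isProbabilityMeasure_particleStep hG hGpos fun x => (hGb x).2)
  refine ⟨isProbabilityMeasure_bind (measurable_empirical N) inferInstance, hη, ?_⟩
  have h4 : RatioBiasBound (terminalParticleLaw ref V N T) (terminalFlow ref V T) _ :=
    h3.fkStep (M := Kernel.id) hG hg hGb
  -- At `r = 1` the terminal resampling adds no bias of its own; what is left is the bound at time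
  -- `T` evaluated at `q`.
  refine h4.tvDist_le.trans (le_of_eq ?_)
  have hq : (1 + ε) ^ 2 ≠ 0 := by positivity
  simp [mul_div_cancel_right₀ _ hq]

end Horizon
end Model

/-- Bernoulli-type bound turning the bias of `T` resampling steps into an explicit particle
count. -/
theorem mul_pow_mul_pow_sub_one_le {q : ℝ} (hq : 1 ≤ q) (T : ℕ) :
    T * (q ^ T * (q ^ T - 1)) ≤ (q ^ 2 - 1) * (T : ℝ) ^ 2 * q ^ (3 * T) / 2 := by
  have h1 : q ^ T - 1 ≤ (q - 1) * (T * q ^ T) := by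
    rw [← mul_geom_sum]
    refine mul_le_mul_of_nonneg_left ?_ (by linarith)
    calc ∑ i ∈ Finset.range T, q ^ i ≤ ∑ _i ∈ Finset.range T, q ^ T :=
          Finset.sum_le_sum fun i hi => pow_le_pow_right₀ hq (Finset.mem_range.1 hi).le
      _ = T * q ^ T := by simp
  have h2 : 1 ≤ q ^ T := one_le_pow₀ hq
  -- Pure slack: this factor turns `q - 1` into `(q² - 1) / 2` and `q^(2T)` into `q^(3T)`.
  have h3 : 1 ≤ q ^ T * ((q + 1) / 2) := one_le_mul_of_one_le_of_one_le h2 (by linarith)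
  calc T * (q ^ T * (q ^ T - 1)) ≤ T * (q ^ T * ((q - 1) * (T * q ^ T))) := by gcongr
    _ = T * (q ^ T * ((q - 1) * (T * q ^ T))) * 1 := (mul_one _).symm
    _ ≤ T * (q ^ T * ((q - 1) * (T * q ^ T))) * (q ^ T * ((q + 1) / 2)) := by
        refine mul_le_mul_of_nonneg_left h3 ?_
        have := sub_nonneg.2 hq
        positivity
    _ = _ := by ring

end SMC

theorem mainTheorem8 {S : ℕ → Type*} [∀ t, MeasurableSpace (S t)] (s₀ : S 0)
    (πref : S 0 → ∀ t, Kernel (SMC.Prefix S t) (S (t + 1)))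
    [∀ s t, IsMarkovKernel (πref s t)]
    (V : S 0 → ∀ t, SMC.Prefix S t → ℝ)
    (T : ℕ) (hT : 2 ≤ T)
    (hVmeas : ∀ t ≤ T, Measurable (V s₀ t))
    (hVpos : ∀ t ≤ T, ∀ x, 0 < V s₀ t x)
    (L : ℝ) (hL : 0 < L) (hratio : SMC.RewardRatioBound (V s₀) T L)
    (ε : ℝ) (hε : 0 ≤ ε) (hbellman : SMC.BellmanErrorBound (πref s₀) (V s₀) T ε)
    (δ : ℝ) (hδ0 : 0 < δ) (hδ1 : δ < 1)
    (N : ℕ) (hN : 1 ≤ N) :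
    SMC.terminalFlow (πref s₀) (V s₀) T = SMC.target (πref s₀) (V s₀) T ∧
    (((1 + ε) ^ 4 - 1) * (T : ℝ) ^ 2 * (1 + ε) ^ (6 * T) / (2 * δ) ≤ (N : ℝ) →
      SMC.tvDist (SMC.smcOutput (πref s₀) (V s₀) N T) (SMC.terminalFlow (πref s₀) (V s₀) T) ≤ δ) ∧
    (ε = 0 →
      SMC.smcOutput (πref s₀) (V s₀) N T = SMC.terminalFlow (πref s₀) (V s₀) T) := by
  have : NeZero N := ⟨by omega⟩
  have hN0 : (0 : ℝ) < N := by exact_mod_cast hN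
  obtain ⟨hout, hflow, htv⟩ := SMC.tvDist_smcOutput_le (ref := πref s₀) hVmeas hVpos hL hratio hε
    hbellman N
  refine ⟨SMC.terminalFlow_eq_target hVmeas hVpos hL hratio, fun hle => htv.trans ?_, ?_⟩
  · have h1 := SMC.mul_pow_mul_pow_sub_one_le (one_le_pow₀ (n := 2) (by linarith : 1 ≤ 1 + ε)) T
    rw [div_le_iff₀ (by positivity)] at hle
    have h2 : (((1 + ε) ^ 2) ^ 2 - 1) * (T : ℝ) ^ 2 * ((1 + ε) ^ 2) ^ (3 * T) =
        ((1 + ε) ^ 4 - 1) * (T : ℝ) ^ 2 * (1 + ε) ^ (6 * T) := by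
      rw [← pow_mul, ← pow_mul, ← mul_assoc]
      norm_num
    rw [h2] at h1
    rw [← mul_div_assoc, div_le_iff₀ hN0]
    linarith
  · rintro rfl
    -- At `ε = 0` the factor `q^T - 1` is zero for every `N`.
    exact SMC.eq_of_tvDist_le_zero (by simpa using htv)
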